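/- Let $K$ be a local field of characteristic $p$, that is, a field of characteristic $p$ complete with respect to a normalized discrete valuation $v_K:K\to\mathbb{Z}\cup\{\infty\}$, with perfect residue field $F$; regard $F$ as a subfield of $K\cong F((t))$. Let $n\ge1$ and let $L/K$ be a totally ramified Galois extension with group $G\cong C_p^n$ which has a single (lower) ramification break $b>0$. Let $v_L$ be the normalized valuation of $L$. Artin–Schreier data for $L/K$ consists of $\beta\in K$, $\omega_1,\dots,\omega_n\in F$ and $\epsilon_1,\dots,\epsilon_n\in K$ such that $v_K(\beta)=-b<v_K(\epsilon_i)$ for all $i$, each $\epsilon_i$ either lies in $F$ or has negative valuation $v_K(\epsilon_i)$ not divisible by $p$, and $L=K(x_1,\dots,x_n)$ with $x_i^p-x_i=\omega_i^{p^n}\beta+\epsilon_i$ for $1\le i\le n$. For $t\in\mathbb{Z}$ let $\mathfrak{a}(t)=-b^{-1}t\in\mathbb{Z}/p^n\mathbb{Z}$ and let $\mathfrak{a}(t)_{(j)}\in\{0,\dots,p-1\}$, $0\le j<n$, be the base-$p$ digits of its representative in $\{0,\dots,p^n-1\}$, so that $\mathfrak{a}(t)=\sum_{j=0}^{n-1}\mathfrak{a}(t)_{(j)}p^j+p^n\mathbb{Z}$.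 A Galois scaffold for $L/K$ with infinite precision consists of $\lambda_w\in L$ $(w\in\mathbb{Z})$ and $\Psi_i\in K[G]$ $(1\le i\le n)$ such that (i) $v_L(\lambda_w)=w$ for all $w$; (ii) $\lambda_{w_1}\lambda_{w_2}^{-1}\in K$ whenever $w_1\equiv w_2\pmod{p^n}$; (iii) $\Psi_i\cdot1=0$ for all $i$; (iv) for all $i,w$ there is a unit $u_{iw}\in\mathcal{O}_K^\times$ such that $\Psi_i(\lambda_w)=u_{iw}\lambda_{w+p^{n-i}b}$ if $\mathfrak{a}(w)_{(n-i)}\ge1$, and $\Psi_i(\lambda_w)=0$ if $\mathfrak{a}(w)_{(n-i)}=0$. Let $A$ be the augmentation ideal of $F[G]$. The group $(1+A)/(1+A^p)$, viewed inside $(F[G]/A^p)^\times$, is an $F$-vector space whose scalar multiplication is the truncated power $x^{[\omega]}=\sum_{i=0}^{p-1}\binom{\omega}{i}(x-1)^i$ with $\binom{\omega}{i}=\omega(\omega-1)\cdots(\omega-i+1)/i!$ for $\omega\in F$. Let $\overline{G}^{[F]}$ be the $F$-span of the image of $G$ in it. **Theorem.** Assume there is Artin–Schreier data $(\beta,(\omega_i),(\epsilon_i))$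 for $L/K$ such that $v_K(\epsilon_i)>-b/p^{n-1}$ for $1\le i\le n$. Then $L/K$ has a Galois scaffold $(\{\lambda_w\},\{\Psi_i\})$ with infinite precision such that $u_{iw}=1$ for all $i,w$ and $\Psi_i\in F[G]$ for $1\le i\le n$. Furthermore, the image of $1+\Psi_i$ in $F[G]/A^p$ lies in $\overline{G}^{[F]}$ for $1\le i\le n$. -/

import Mathlib

open scoped BigOperators

noncomputable section

namespace RefinedBreaks

/-! ### Local fields and their totally ramified extensions -/

/-- `v` is a normalized discrete valuation `K → ℤ ∪ {∞}` for which `K` is complete, and the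
subfield `F` of `K` is mapped isomorphically onto the residue field of `v`.  For `F` perfect of
characteristic `p` this says that `K ≅ F((t))` is a local field of characteristic `p` with
residue field `F`. -/
structure IsLocalField (F : Type*) {K : Type*} [Field F] [Field K] [Algebra F K]
    (v : AddValuation K (WithTop ℤ)) : Prop where
  normalized : Function.Surjective v
  complete : ∀ u : ℕ → K,
    (∀ N : ℤ, ∃ M : ℕ, ∀ k ≥ M, ∀ l ≥ M, (N : WithTop ℤ) ≤ v (u k - u l)) →
    ∃ x : K, ∀ N : ℤ, ∃ M : ℕ, ∀ k ≥ M, (N : WithTop ℤ) ≤ v (u k - x)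
  map_coeff : ∀ c : F, c ≠ 0 → v (algebraMap F K c) = 0
  residue_surjective : ∀ x : K, 0 ≤ v x → ∃ c : F, 0 < v (x - algebraMap F K c)

/-- `vL` is the normalized valuation of `L`, it extends `vK` up to the ramification index, and
the ramification index is `[L : K]`. -/
structure IsTotallyRamified {K L : Type*} [Field K] [Field L] [Algebra K L]
    (vK : AddValuation K (WithTop ℤ)) (vL : AddValuation L (WithTop ℤ)) : Prop where
  normalized : Function.Surjective vL
  map_base : ∀ x : K, vL (algebraMap K L x) = Module.finrank K L • vK x

section Galois

variable {K L : Type*} [Field K] [Field L] [Algebra K L]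

/-- The lower ramification group `G_i`, as a subset of the Galois group:
all `σ` with `v_L(σ(x) - x) ≥ i + 1` for every `x ∈ O_L`. -/
def ramificationGroup (vL : AddValuation L (WithTop ℤ)) (i : ℤ) : Set Gal(L/K) :=
  {σ | ∀ x : L, 0 ≤ vL x → ((i + 1 : ℤ) : WithTop ℤ) ≤ vL (σ x - x)}

variable (K) in
/-- The set of (lower) ramification breaks of `L/K`. -/
def ramificationBreaks (vL : AddValuation L (WithTop ℤ)) : Set ℤ :=
  {i | (ramificationGroup vL i : Set Gal(L/K)) ≠ ramificationGroup vL (i + 1)}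

/-- The action of the group ring `K[G]`, `G = Gal(L/K)`, on `L`. -/
def galAction : MonoidAlgebra K Gal(L/K) →ₐ[K] Module.End K L :=
  MonoidAlgebra.lift K (Module.End K L) Gal(L/K) (AlgEquiv.toLinearMapHom K L)

theorem galAction_single (σ : Gal(L/K)) (c : K) (x : L) :
    galAction (MonoidAlgebra.single σ c) x = c • σ x := by
  simp [galAction]

end Galois

/-! ### Artin–Schreier data -/

/-- `(β, ω, ε)` is Artin–Schreier data for the `C_p^n`-extension `L/K` with ramification
break `b`: `L` is generated over `K` by roots `x i` of `X^p - X - (ω_i^{p^n} β + ε_i)`, where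
`v_K(β) = -b < v_K(ε_i)`, and each `ε_i` is reduced, i.e. it lies in the coefficient field `F`
or its valuation is negative and prime to `p`. -/
structure IsArtinSchreierData (F : Type*) {K : Type*} (L : Type*) [Field F] [Field K] [Field L]
    [Algebra F K] [Algebra K L] (vK : AddValuation K (WithTop ℤ)) (p n b : ℕ)
    (β : K) (ω : Fin n → F) (ε : Fin n → K) : Prop where
  val_beta : vK β = ((-b : ℤ) : WithTop ℤ)
  val_eps : ∀ i, ((-b : ℤ) : WithTop ℤ) < vK (ε i)
  reduced : ∀ i, (∃ c : F, algebraMap F K c = ε i) ∨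
    ∃ m : ℤ, vK (ε i) = (m : WithTop ℤ) ∧ m < 0 ∧ ¬ (p : ℤ) ∣ m
  generates : ∃ x : Fin n → L,
    (∀ i, x i ^ p - x i = algebraMap K L (algebraMap F K (ω i) ^ p ^ n * β + ε i)) ∧
    IntermediateField.adjoin K (Set.range x) = ⊤

/-! ### Galois scaffolds -/

/-- The map `𝔞 : ℤ → ℤ/p^n`, `𝔞(t) = -b⁻¹ t`. -/
def frakA (p n b : ℕ) (t : ℤ) : ZMod (p ^ n) :=
  -(b : ZMod (p ^ n))⁻¹ * (t : ZMod (p ^ n))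

/-- The digit `𝔞(t)_{(j)}` in the base `p` expansion of the representative of `𝔞(t)` in
`{0, …, p^n - 1}`. -/
def digitA (p n b : ℕ) (t : ℤ) (j : ℕ) : ℕ :=
  (frakA p n b t).val / p ^ j % p

/-- `(lam, Ψ)` is a Galois scaffold with infinite precision for `L/K` with units `u`.
The index `i : Fin n` stands for the index `i + 1` in `{1, …, n}`. -/
structure IsGaloisScaffold {K L : Type*} [Field K] [Field L] [Algebra K L]
    (vK : AddValuation K (WithTop ℤ)) (vL : AddValuation L (WithTop ℤ)) (p n b : ℕ)
    (lam : ℤ → L) (Ψ : Fin n → MonoidAlgebra K Gal(L/K)) (u : Fin n → ℤ → K) : Prop where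
  val_lam : ∀ w, vL (lam w) = (w : WithTop ℤ)
  lam_div : ∀ w₁ w₂, w₁ ≡ w₂ [ZMOD (p : ℤ) ^ n] → ∃ c : K, lam w₁ * (lam w₂)⁻¹ = algebraMap K L c
  act_one : ∀ i, galAction (Ψ i) (1 : L) = 0
  unit : ∀ i w, vK (u i w) = 0
  act_lam : ∀ i w, galAction (Ψ i) (lam w) =
    if 1 ≤ digitA p n b w (n - (i + 1)) then
      algebraMap K L (u i w) * lam (w + (p : ℤ) ^ (n - (i + 1 : ℕ)) * b)
    else 0

/-! ### Truncated powers and the `F`-span of the Galois group -/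

/-- The binomial coefficient `ω(ω-1)⋯(ω-(i-1))/i!` for `ω` in a field. -/
def fieldBinom {F : Type*} [Field F] (ω : F) (i : ℕ) : F :=
  (∏ j ∈ Finset.range i, (ω - j)) / (i.factorial : F)

/-- The truncated power `x^{[ω]} = (1 + (x - 1))^{[ω]} = ∑_{i < p} binom(ω, i) (x - 1)^i`. -/
def truncPow (p : ℕ) {F S : Type*} [Field F] [Ring S] [Algebra F S] (ω : F) (x : S) : S :=
  ∑ i ∈ Finset.range p, fieldBinom ω i • (x - 1) ^ i

section GroupRing

variable (F G : Type*) [Field F] [Group G]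

/-- The augmentation ideal `A` of the group ring `F[G]`. -/
def augIdeal : Ideal (MonoidAlgebra F G) :=
  RingHom.ker (MonoidAlgebra.lift F F G (1 : G →* F))

instance : (augIdeal F G).IsTwoSided := by
  unfold augIdeal; infer_instance

/-- The quotient ring `F[G] / A^k`. -/
abbrev Rbar (k : ℕ) : Type _ := MonoidAlgebra F G ⧸ (augIdeal F G) ^ k

/-- The `F`-span of the image of `G` in the group `(1 + A)/(1 + A^p) ⊆ (F[G]/A^p)ˣ`, whose
`F`-vector space structure has multiplication as its addition and the truncated power
`(ω, x) ↦ x^{[ω]}` as its scalar multiplication: the smallest set that contains the image of `G`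
and is closed under the two operations. -/
inductive InTruncSpan (p : ℕ) : Rbar F G p → Prop
  | of (g : G) : InTruncSpan p (Ideal.Quotient.mk _ (MonoidAlgebra.of F G g))
  | mul {x y : Rbar F G p} : InTruncSpan p x → InTruncSpan p y → InTruncSpan p (x * y)
  | pow (ω : F) {x : Rbar F G p} : InTruncSpan p x → InTruncSpan p (truncPow p ω x)

end GroupRing

end RefinedBreaks

end

/-! Artin–Schreier roots allow an elimination. If `y_i^p - y_i = a_i Y + e_i` and `a_k ≠ 0`, choose
`d_i` in the perfect field `F` with `d_i^p = a_i / a_k`; then `y_i - d_i y_k` satisfies an equation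
of the same form with `Y` replaced by `y_k`, whose valuation is `p` times smaller in absolute value.
The bound on `ε_i` says `v_L(ε_i) > -bp`, so the error never dominates, and the single break forces
each pivot `a_k` to be nonzero. The result (`exists_unitriangular_generators`) is a family `X_i`
with `v_L(X_i) = -b p^(n-i)` that suitable Galois elements translate by a unitriangular matrix over
`F`.

Group elements act on products of binomials `binom(X_i, f_i)`, `f_i < p`, by translating the `X_i`.
By Vandermonde, truncated powers of unit coordinate translations realize all `F`-multiples, so the
matrix can be inverted inside the truncated span (`exists_isTranslation_single`), giving `Θ_k` that
translates `X_k` alone by `1`. By Pascal's rule `Ψ_k = Θ_k - 1` lowers `f_k` by one exactly. With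
`f` the digits of `𝔞(w)` and a power of a uniformizer of `K` as a factor, the binomial products have
valuation `w` and form the scaffold (`isGaloisScaffold_of_isTranslation`). -/

namespace RefinedBreaks


/-! ### Integer arithmetic of valuations and Artin–Schreier equations -/

section Valuation

variable {K : Type*} [Field K] (v : AddValuation K (WithTop ℤ))

theorem exists_int_val {x : K} (hx : x ≠ 0) : ∃ k : ℤ, v x = (k : WithTop ℤ) := by
  obtain ⟨k, hk⟩ := WithTop.ne_top_iff_exists.mp ((AddValuation.ne_top_iff v).mpr hx)
  exact ⟨k, hk.symm⟩

theorem ne_zero_of_val_eq_int {x : K} {k : ℤ} (h : v x = (k : WithTop ℤ)) : x ≠ 0 := by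
  rintro rfl
  simp at h

theorem nsmul_coe_withTop (m : ℕ) (k : ℤ) :
    m • (k : WithTop ℤ) = (((m : ℤ) * k : ℤ) : WithTop ℤ) := by
  rw [← WithTop.coe_nsmul, nsmul_eq_mul]

theorem val_mul_int {x y : K} {k l : ℤ} (hx : v x = (k : WithTop ℤ)) (hy : v y = (l : WithTop ℤ)) :
    v (x * y) = ((k + l : ℤ) : WithTop ℤ) := by
  rw [AddValuation.map_mul, hx, hy, WithTop.coe_add]

theorem val_pow_int {x : K} {k : ℤ} (hx : v x = (k : WithTop ℤ)) (m : ℕ) :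
    v (x ^ m) = ((m * k : ℤ) : WithTop ℤ) := by
  rw [AddValuation.map_pow, hx, nsmul_coe_withTop]

theorem val_inv_int {x : K} {k : ℤ} (hx : v x = (k : WithTop ℤ)) :
    v x⁻¹ = ((-k : ℤ) : WithTop ℤ) := by
  have h0 := ne_zero_of_val_eq_int v hx
  obtain ⟨l, hl⟩ := exists_int_val v (inv_ne_zero h0)
  have h := val_mul_int v hx hl
  rw [mul_inv_cancel₀ h0, AddValuation.map_one] at h
  have : (0 : ℤ) = k + l := by exact_mod_cast h
  rw [hl]
  congr 1
  omega

theorem val_div_int {x y : K} {k l : ℤ} (hx : v x = (k : WithTop ℤ)) (hy : v y = (l : WithTop ℤ)) :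
    v (x / y) = ((k - l : ℤ) : WithTop ℤ) := by
  rw [div_eq_mul_inv, val_mul_int v hx (val_inv_int v hy), sub_eq_add_neg]

theorem val_zpow_int {x : K} {k : ℤ} (hx : v x = (k : WithTop ℤ)) (m : ℤ) :
    v (x ^ m) = ((m * k : ℤ) : WithTop ℤ) := by
  rcases m with m | m
  · simpa using val_pow_int v hx m
  · rw [zpow_negSucc, val_inv_int v (val_pow_int v hx (m + 1))]
    congr 1
    push_cast [Int.negSucc_eq]
    ring

theorem exists_val_eq_one (hv : Function.Surjective v) : ∃ x : K, v x = ((1 : ℤ) : WithTop ℤ) :=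
  hv _

/-- A root with `v y ≥ 0` would make the right side integral; otherwise `y ^ p` strictly dominates
`y`, so the valuation of the root can be read off. -/
theorem val_pow_eq_of_lt {p : ℕ} (hp : 1 < p) {y : K} {k : ℤ}
    (h : v (y ^ p - y) = ((p * k : ℤ) : WithTop ℤ)) (hk : k < 0) : v y = (k : WithTop ℤ) := by
  have hp0 : (0 : ℤ) < p := by omega
  have hy : y ≠ 0 := by
    rintro rfl
    rw [zero_pow (by omega), sub_zero, AddValuation.map_zero] at h
    exact absurd h.symm (WithTop.coe_ne_top)
  obtain ⟨m, hm⟩ := exists_int_val v hy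
  have hmp := val_pow_int v hm p
  have hm0 : m < 0 := by
    by_contra! hm0
    have : ((0 : ℤ) : WithTop ℤ) ≤ v (y ^ p - y) := by
      apply AddValuation.map_le_sub
      · rw [hmp]; exact_mod_cast (by positivity)
      · rw [hm]; exact_mod_cast hm0
    rw [h, WithTop.coe_le_coe] at this
    nlinarith
  have hlt : v (y ^ p) < v y := by
    rw [hmp, hm, WithTop.coe_lt_coe]
    nlinarith [(by exact_mod_cast hp : (1 : ℤ) < p)]
  rw [AddValuation.map_sub_eq_of_lt_left v hlt, hmp, WithTop.coe_inj] at h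
  rw [hm, mul_left_cancel₀ hp0.ne' h]

theorem lt_val_of_lt_val_pow_sub {p : ℕ} (hp : 1 < p) {y : K} {k : ℤ}
    (h : ((p * k : ℤ) : WithTop ℤ) < v (y ^ p - y)) (hk : k < 0) : (k : WithTop ℤ) < v y := by
  have hp0 : (0 : ℤ) < p := by omega
  by_contra! hle
  have hy : y ≠ 0 := by
    rintro rfl
    simp at hle
  obtain ⟨m, hm⟩ := exists_int_val v hy
  have hmp := val_pow_int v hm p
  rw [hm, WithTop.coe_le_coe] at hle
  have hlt : v (y ^ p) < v y := by
    rw [hmp, hm, WithTop.coe_lt_coe]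
    nlinarith [(by exact_mod_cast hp : (1 : ℤ) < p)]
  rw [AddValuation.map_sub_eq_of_lt_left v hlt, hmp, WithTop.coe_lt_coe] at h
  nlinarith

end Valuation

/-! ### Galois invariance of the valuation in a totally ramified extension -/

section Galois

variable {K L : Type*} [Field K] [Field L] [Algebra K L]
  {vK : AddValuation K (WithTop ℤ)} {vL : AddValuation L (WithTop ℤ)}

theorem IsTotallyRamified.val_base (hL : IsTotallyRamified vK vL) {x : K} {k : ℤ}
    (hx : vK x = (k : WithTop ℤ)) :
    vL (algebraMap K L x) = ((Module.finrank K L * k : ℤ) : WithTop ℤ) := by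
  rw [hL.map_base, hx, nsmul_coe_withTop]

/-- A nontrivial relation among `1, π, …, π^N`, with `N = [L : K]` and `π` a uniformizer, has
exactly two terms of minimal valuation, the first and the last. -/
theorem IsTotallyRamified.exists_relation [FiniteDimensional K L] (hL : IsTotallyRamified vK vL)
    {π : L} (hπ : vL π = ((1 : ℤ) : WithTop ℤ)) :
    ∃ (a : ℕ → K) (m : ℤ), ∑ i ∈ Finset.range (Module.finrank K L + 1), a i • π ^ i = 0 ∧
      vK (a 0) = ((m + 1 : ℤ) : WithTop ℤ) ∧ vK (a (Module.finrank K L)) = (m : WithTop ℤ) ∧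
      ∀ i, 0 < i → i < Module.finrank K L → ((m + 1 : ℤ) : WithTop ℤ) ≤ vK (a i) := by
  set N := Module.finrank K L with hN
  have hNpos : 0 < N := Module.finrank_pos
  have hdep : ¬ LinearIndependent K (fun i : Fin (N + 1) => π ^ (i : ℕ)) := by
    intro h
    have := h.fintype_card_le_finrank
    simp [← hN] at this
  rw [Fintype.not_linearIndependent_iff] at hdep
  obtain ⟨g, hg, j, hj⟩ := hdep
  let a : ℕ → K := fun i => if h : i < N + 1 then g ⟨i, h⟩ else 0
  have hsum : ∑ i ∈ Finset.range (N + 1), a i • π ^ i = 0 := by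
    rw [← hg, Finset.sum_range]
    refine Finset.sum_congr rfl fun i _ => ?_
    simp only [a, dif_pos i.isLt]
  have haj : a j ≠ 0 := by simpa only [a, dif_pos j.isLt] using hj
  obtain ⟨r, hr, hmin⟩ := Finset.exists_min_image (Finset.range (N + 1))
    (fun i => vL (a i • π ^ i)) ⟨0, by simp⟩
  have hterm : ∀ i (k : ℤ), vK (a i) = (k : WithTop ℤ) →
      vL (a i • π ^ i) = ((N * k + i : ℤ) : WithTop ℤ) := by
    intro i k hk
    rw [Algebra.smul_def, val_mul_int vL (hL.val_base hk) (val_pow_int vL hπ i), mul_one]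
  have hπ0 := ne_zero_of_val_eq_int vL hπ
  have har : a r ≠ 0 := by
    intro h0
    obtain ⟨k, hk⟩ := exists_int_val vK haj
    have := hmin j (Finset.mem_range.mpr j.isLt)
    simp only [h0, zero_smul, AddValuation.map_zero, hterm _ k hk] at this
    exact WithTop.coe_ne_top (top_le_iff.mp this)
  obtain ⟨kr, hkr⟩ := exists_int_val vK har
  -- A vanishing sum cannot have a unique term of least valuation.
  have hother : ∃ s ∈ Finset.range (N + 1), s ≠ r ∧ vL (a s • π ^ s) = vL (a r • π ^ r) := by
    by_contra! hne
    have hlt : ∀ i ∈ (Finset.range (N + 1)).erase r, vL (a r • π ^ r) < vL (a i • π ^ i) := by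
      intro i hi
      rw [Finset.mem_erase] at hi
      exact lt_of_le_of_ne (hmin i hi.2) (hne i hi.2 hi.1).symm
    have hs := AddValuation.map_lt_sum vL (by rw [hterm r kr hkr]; exact WithTop.coe_ne_top) hlt
    rw [← Finset.add_sum_erase _ _ hr, add_eq_zero_iff_eq_neg'] at hsum
    rw [hsum, AddValuation.map_neg] at hs
    exact lt_irrefl _ hs
  obtain ⟨s, hs, hsr, hval⟩ := hother
  have has : a s ≠ 0 := by
    intro h0
    rw [h0, zero_smul, AddValuation.map_zero, hterm r kr hkr] at hval
    exact WithTop.coe_ne_top hval.symm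
  obtain ⟨ks, hks⟩ := exists_int_val vK has
  rw [hterm r kr hkr, hterm s ks hks, WithTop.coe_inj] at hval
  rw [Finset.mem_range] at hr hs
  -- The `i`-th term has valuation congruent to `i` modulo `N`, so the two distinct minimal indices
  -- in `0, …, N` must be `0` and `N`.
  have key : ∃ m : ℤ, vK (a 0) = ((m + 1 : ℤ) : WithTop ℤ) ∧ vK (a N) = (m : WithTop ℤ) ∧
      (N * kr + r : ℤ) = N * m + N := by
    have hNz : (0 : ℤ) < N := by exact_mod_cast hNpos
    have hd : (N : ℤ) * (ks - kr) = r - s := by linarith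
    rcases lt_or_gt_of_ne hsr with h | h
    · have h1 : 0 < ks - kr := by
        by_contra! h1
        nlinarith
      have h2 : ks - kr = 1 := by
        by_contra h2
        have : 2 ≤ ks - kr := by omega
        nlinarith
      rw [h2] at hd
      have hr' : r = N := by omega
      have hs' : s = 0 := by omega
      subst hr' hs'
      refine ⟨kr, ?_, hkr, by simp⟩
      rw [hks]; congr 1; omega
    · have h1 : ks - kr < 0 := by
        by_contra! h1
        nlinarith
      have h2 : ks - kr = -1 := by
        by_contra h2
        have : ks - kr ≤ -2 := by omega
        nlinarith
      rw [h2] at hd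
      have hr' : r = 0 := by omega
      have hs' : s = N := by omega
      subst hr' hs'
      refine ⟨ks, ?_, hks, ?_⟩
      · rw [hkr]; congr 1; omega
      · push_cast; linarith
  obtain ⟨m, hm0, hmN, hm⟩ := key
  refine ⟨a, m, hsum, hm0, hmN, fun i hi0 hiN => ?_⟩
  by_cases hai : a i = 0
  · simp [hai]
  obtain ⟨k, hk⟩ := exists_int_val vK hai
  have := hmin i (by simp; omega)
  simp only [hterm r kr hkr, hterm i k hk, WithTop.coe_le_coe] at this
  rw [hk, WithTop.coe_le_coe]
  by_contra! hlt
  have : k ≤ m := by omega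
  nlinarith

/-- The Newton polygon of the relation for `π` has a single slope: if `v π < 1` the top term alone
is minimal for `v`, if `v π > 1` the constant term alone is, and either contradicts the vanishing of
the sum. -/
theorem IsTotallyRamified.val_uniformizer_eq [FiniteDimensional K L]
    (hL : IsTotallyRamified vK vL) {v : AddValuation L (WithTop ℤ)} (hv : IsTotallyRamified vK v)
    {π : L} (hπ : vL π = ((1 : ℤ) : WithTop ℤ)) : v π = ((1 : ℤ) : WithTop ℤ) := by
  obtain ⟨a, m, hsum, h0, hN, hi⟩ := hL.exists_relation hπ
  set N := Module.finrank K L with hNdef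
  have hNpos : 0 < N := Module.finrank_pos
  have hNz : (0 : ℤ) < N := by exact_mod_cast hNpos
  have hπ0 := ne_zero_of_val_eq_int vL hπ
  obtain ⟨s, hs⟩ := exists_int_val v hπ0
  have hterm : ∀ i (k : ℤ), vK (a i) = (k : WithTop ℤ) →
      v (a i • π ^ i) = ((N * k + i * s : ℤ) : WithTop ℤ) := by
    intro i k hk
    rw [Algebra.smul_def, val_mul_int v (hv.val_base hk) (val_pow_int v hs i)]
  have hmid : ∀ i, 0 < i → i < N →
      ((N * (m + 1) + i * s : ℤ) : WithTop ℤ) ≤ v (a i • π ^ i) := by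
    intro i h1 h2
    by_cases hai : a i = 0
    · simp [hai]
    obtain ⟨k, hk⟩ := exists_int_val vK hai
    have h := hi i h1 h2
    rw [hk, WithTop.coe_le_coe] at h
    rw [hterm i k hk, WithTop.coe_le_coe]
    nlinarith
  have hno : ∀ j ∈ Finset.range (N + 1), v (a j • π ^ j) ≠ ⊤ →
      ¬ ∀ i ∈ (Finset.range (N + 1)).erase j, v (a j • π ^ j) < v (a i • π ^ i) := by
    intro j hj htop hlt
    have hs := AddValuation.map_lt_sum v htop hlt
    rw [← Finset.add_sum_erase _ _ hj, add_eq_zero_iff_eq_neg'] at hsum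
    rw [hsum, AddValuation.map_neg] at hs
    exact lt_irrefl _ hs
  have e0 := hterm 0 _ h0
  have eN := hterm N _ hN
  rw [hs, WithTop.coe_inj]
  rcases lt_trichotomy s 1 with h | h | h
  · exfalso
    refine hno N (by simp) (by rw [eN]; exact WithTop.coe_ne_top) fun i hi => ?_
    rw [Finset.mem_erase, Finset.mem_range] at hi
    rw [eN]
    rcases Nat.eq_zero_or_pos i with rfl | hipos
    · rw [e0, WithTop.coe_lt_coe]
      push_cast
      nlinarith
    · refine lt_of_lt_of_le ?_ (hmid i hipos (by omega))
      rw [WithTop.coe_lt_coe]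
      have h1 : (i : ℤ) < N := by omega
      have h2 : (0 : ℤ) < i := by omega
      nlinarith
  · exact h
  · exfalso
    refine hno 0 (by simp) (by rw [e0]; exact WithTop.coe_ne_top) fun i hi => ?_
    rw [Finset.mem_erase, Finset.mem_range] at hi
    rw [e0]
    rcases eq_or_ne i N with rfl | hiN
    · rw [eN, WithTop.coe_lt_coe]
      push_cast
      nlinarith
    · refine lt_of_lt_of_le ?_ (hmid i (by omega) (by omega))
      rw [WithTop.coe_lt_coe]
      have h2 : (0 : ℤ) < i := by omega
      push_cast
      nlinarith

/-- A totally ramified extension has only one normalized valuation. -/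
theorem IsTotallyRamified.unique [FiniteDimensional K L]
    (hL : IsTotallyRamified vK vL) {v : AddValuation L (WithTop ℤ)} (hv : IsTotallyRamified vK v)
    (y : L) : v y = vL y := by
  by_cases hy : y = 0
  · simp [hy]
  obtain ⟨k, hk⟩ := exists_int_val vL hy
  obtain ⟨π, hπ⟩ := exists_val_eq_one vL hL.normalized
  have hπ0 := ne_zero_of_val_eq_int vL hπ
  -- Uniformizers generate the multiplicative group: `y` is this one times a power of `π`.
  have hu : vL (y * π ^ (1 - k)) = ((1 : ℤ) : WithTop ℤ) := by
    rw [val_mul_int vL hk (val_zpow_int vL hπ _)]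
    congr 1; ring
  have h1 := hL.val_uniformizer_eq hv hu
  have h2 := val_zpow_int v (hL.val_uniformizer_eq hv hπ) (k - 1)
  have : y = y * π ^ (1 - k) * π ^ (k - 1) := by
    rw [mul_assoc, ← zpow_add₀ hπ0]
    simp
  rw [this, val_mul_int v h1 h2, ← this, hk]
  congr 1; ring

/-- The pullback of `vL` along `σ` is again normalized and totally ramified over `vK`, so uniqueness
applies. -/
theorem IsTotallyRamified.val_galois [FiniteDimensional K L]
    (hL : IsTotallyRamified vK vL) (σ : Gal(L/K)) (y : L) : vL (σ y) = vL y := by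
  refine hL.unique (v := vL.comap (σ : L →+* L)) ⟨?_, ?_⟩ y
  · intro k
    obtain ⟨z, hz⟩ := hL.normalized k
    refine ⟨σ.symm z, ?_⟩
    change vL (σ (σ.symm z)) = k
    rw [AlgEquiv.apply_symm_apply, hz]
  · intro x
    change vL (σ (algebraMap K L x)) = _
    rw [AlgEquiv.commutes, hL.map_base]

/-! ### How far Galois elements move elements when the only break is `b` -/

section SingleBreak

variable [FiniteDimensional K L] {b : ℕ}

/-- Galois invariance of `vL` puts everything in the group of index `-1`, and the filtration cannot
drop before index `b`. -/
theorem mem_ramificationGroup_of_breaks (hL : IsTotallyRamified vK vL)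
    (hbreak : ramificationBreaks K vL = {(b : ℤ)}) (σ : Gal(L/K)) :
    σ ∈ ramificationGroup vL (b : ℤ) := by
  have h : ∀ j : ℕ, j ≤ b + 1 → σ ∈ ramificationGroup vL ((j : ℤ) - 1) := by
    intro j
    induction j with
    | zero =>
      intro _ x hx
      refine le_trans ?_ (AddValuation.map_sub vL _ _)
      rw [hL.val_galois, min_self]
      simpa using hx
    | succ j ih =>
      intro hj
      have h1 := ih (by omega)
      have h2 : ((j : ℤ) - 1) ∉ ramificationBreaks K vL := by
        rw [hbreak, Set.mem_singleton_iff]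
        omega
      simp only [ramificationBreaks, Set.mem_ofPred_eq, not_not] at h2
      rw [h2] at h1
      convert h1 using 2
      push_cast; ring
  simpa using h (b + 1) le_rfl

/-- The map `y ↦ σ y / y` is multiplicative, so the bound passes from uniformizers, where membership
in the group of index `b` gives it, to all nonzero elements. -/
theorem le_val_galois_div_sub_one (hL : IsTotallyRamified vK vL)
    (hbreak : ramificationBreaks K vL = {(b : ℤ)}) (σ : Gal(L/K)) {y : L} (hy : y ≠ 0) :
    ((b : ℤ) : WithTop ℤ) ≤ vL (σ y / y - 1) := by
  have hunif : ∀ z : L, vL z = ((1 : ℤ) : WithTop ℤ) →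
      ((b : ℤ) : WithTop ℤ) ≤ vL (σ z / z - 1) := by
    intro z hz
    have hz0 := ne_zero_of_val_eq_int vL hz
    have h := mem_ramificationGroup_of_breaks hL hbreak σ z
      (by rw [hz]; exact_mod_cast zero_le_one)
    by_cases hzero : σ z - z = 0
    · rw [show σ z / z - 1 = (σ z - z) / z by field_simp, hzero]
      simp
    obtain ⟨k, hk⟩ := exists_int_val vL hzero
    rw [show σ z / z - 1 = (σ z - z) / z by field_simp, val_div_int vL hk hz]
    rw [hk, WithTop.coe_le_coe] at h
    rw [WithTop.coe_le_coe]
    omega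
  have hbnn : (0 : WithTop ℤ) ≤ ((b : ℤ) : WithTop ℤ) := by exact_mod_cast Int.natCast_nonneg b
  have hmul : ∀ z w : L, z ≠ 0 → w ≠ 0 → ((b : ℤ) : WithTop ℤ) ≤ vL (σ z / z - 1) →
      ((b : ℤ) : WithTop ℤ) ≤ vL (σ w / w - 1) →
      ((b : ℤ) : WithTop ℤ) ≤ vL (σ (z * w) / (z * w) - 1) := by
    intro z w hz hw h1 h2
    have : σ (z * w) / (z * w) - 1 = (σ z / z) * (σ w / w - 1) + (σ z / z - 1) := by
      rw [map_mul]
      field_simp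
      ring
    rw [this]
    apply AddValuation.map_le_add _ _ h1
    have hu : vL (σ z / z) = 0 := by
      obtain ⟨k, hk⟩ := exists_int_val vL hz
      rw [val_div_int vL (by rw [hL.val_galois, hk]) hk]
      simp
    rw [AddValuation.map_mul, hu, zero_add]
    exact h2
  have hinv : ∀ z : L, z ≠ 0 → ((b : ℤ) : WithTop ℤ) ≤ vL (σ z / z - 1) →
      ((b : ℤ) : WithTop ℤ) ≤ vL (σ z⁻¹ / z⁻¹ - 1) := by
    intro z hz h1
    have hsz : σ z ≠ 0 := by simpa using hz
    have : σ z⁻¹ / z⁻¹ - 1 = -((σ z / z - 1) * (z / σ z)) := by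
      rw [map_inv₀]
      field_simp
      ring
    have hu : vL (z / σ z) = 0 := by
      obtain ⟨k, hk⟩ := exists_int_val vL hz
      rw [val_div_int vL hk (by rw [hL.val_galois, hk])]
      simp
    rw [this, AddValuation.map_neg, AddValuation.map_mul, hu, add_zero]
    exact h1
  obtain ⟨π, hπ⟩ := exists_val_eq_one vL hL.normalized
  have hπ0 := ne_zero_of_val_eq_int vL hπ
  have hpow : ∀ (z : L), z ≠ 0 → ((b : ℤ) : WithTop ℤ) ≤ vL (σ z / z - 1) → ∀ m : ℕ,
      ((b : ℤ) : WithTop ℤ) ≤ vL (σ (z ^ m) / z ^ m - 1) := by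
    intro z hz h m
    induction m with
    | zero => simp
    | succ m ih =>
      rw [pow_succ]
      exact hmul _ _ (pow_ne_zero _ hz) hz ih h
  have hzpow : ∀ m : ℤ, ((b : ℤ) : WithTop ℤ) ≤ vL (σ (π ^ m) / π ^ m - 1) := by
    intro m
    rcases m with m | m
    · simpa using hpow π hπ0 (hunif π hπ) m
    · rw [zpow_negSucc]
      exact hinv _ (pow_ne_zero _ hπ0) (hpow π hπ0 (hunif π hπ) _)
  obtain ⟨k, hk⟩ := exists_int_val vL hy
  have hu : vL (y * π ^ (1 - k)) = ((1 : ℤ) : WithTop ℤ) := by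
    rw [val_mul_int vL hk (val_zpow_int vL hπ _)]
    congr 1; ring
  have : y = y * π ^ (1 - k) * π ^ (k - 1) := by
    rw [mul_assoc, ← zpow_add₀ hπ0]
    simp
  rw [this]
  exact hmul _ _ (mul_ne_zero hy (zpow_ne_zero _ hπ0)) (zpow_ne_zero _ hπ0) (hunif _ hu) (hzpow _)

theorem add_le_val_galois_sub (hL : IsTotallyRamified vK vL)
    (hbreak : ramificationBreaks K vL = {(b : ℤ)}) (σ : Gal(L/K)) (y : L) :
    vL y + ((b : ℤ) : WithTop ℤ) ≤ vL (σ y - y) := by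
  by_cases hy : y = 0
  · simp [hy]
  rw [show σ y - y = y * (σ y / y - 1) by field_simp, AddValuation.map_mul]
  gcongr
  exact le_val_galois_div_sub_one hL hbreak σ hy

/-- If `p ∣ v_L(y)` then `σ - 1` raises the valuation of `y` by more than the break. -/
theorem add_lt_val_galois_sub_of_dvd (hL : IsTotallyRamified vK vL) (p : ℕ) [Fact p.Prime]
    [CharP L p] (hb : 0 < b)
    (hbreak : ramificationBreaks K vL = {(b : ℤ)}) (σ : Gal(L/K)) {y : L} {k : ℤ}
    (hy : vL y = ((p * k : ℤ) : WithTop ℤ)) :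
    ((p * k + b : ℤ) : WithTop ℤ) < vL (σ y - y) := by
  have hp : 1 < p := (Fact.out : p.Prime).one_lt
  have hy0 := ne_zero_of_val_eq_int vL hy
  obtain ⟨π, hπ⟩ := exists_val_eq_one vL hL.normalized
  have hπ0 := ne_zero_of_val_eq_int vL hπ
  set z := π ^ k with hz
  have hz0 : z ≠ 0 := zpow_ne_zero _ hπ0
  have hzv : vL z = (k : WithTop ℤ) := by
    rw [val_zpow_int vL hπ, mul_one]
  -- In `y = z ^ p * u` the factor `z ^ p` is moved by a relative amount of valuation at least `p *
  -- b > b`, and the unit `u` by at least `b + 1`.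
  set u := y / z ^ p with hu
  have hu0 : u ≠ 0 := div_ne_zero hy0 (pow_ne_zero _ hz0)
  have huv : vL u = ((0 : ℤ) : WithTop ℤ) := by
    rw [val_div_int vL hy (val_pow_int vL hzv p), sub_self]
  have h1 : ((b : ℤ) : WithTop ℤ) < vL ((σ z / z) ^ p - 1) := by
    have h := le_val_galois_div_sub_one hL hbreak σ hz0
    rw [show (σ z / z) ^ p - 1 = (σ z / z - 1) ^ p by rw [sub_pow_char, one_pow],
      AddValuation.map_pow]
    by_cases h0 : σ z / z - 1 = 0
    -- Splitting off one summand shows that the multiple `p • ⊤` is `⊤`.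
    · rw [h0, AddValuation.map_zero, show p = (p - 1) + 1 by omega, succ_nsmul]
      simp
    obtain ⟨m, hm⟩ := exists_int_val vL h0
    rw [hm, WithTop.coe_le_coe] at h
    rw [hm, nsmul_coe_withTop, WithTop.coe_lt_coe]
    have : (1 : ℤ) < p := by exact_mod_cast hp
    nlinarith
  have h2 : ((b : ℤ) : WithTop ℤ) < vL (σ u - u) := by
    refine lt_of_lt_of_le ?_ (mem_ramificationGroup_of_breaks hL hbreak σ u (by rw [huv]; simp))
    rw [WithTop.coe_lt_coe]
    omega
  have hsum : σ y - y = z ^ p * ((σ z / z) ^ p * (σ u - u) + ((σ z / z) ^ p - 1) * u) := by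
    have : y = z ^ p * u := by rw [hu]; field_simp
    rw [this, map_mul, map_pow, div_pow]
    have hzp0 := pow_ne_zero p hz0
    field_simp
    ring
  have hzp := val_pow_int vL hzv p
  have hin : ((b : ℤ) : WithTop ℤ) < vL ((σ z / z) ^ p * (σ u - u) + ((σ z / z) ^ p - 1) * u) := by
    apply AddValuation.map_lt_add
    · have : vL (σ z / z) = ((0 : ℤ) : WithTop ℤ) := by
        rw [val_div_int vL (by rw [hL.val_galois, hzv]) hzv, sub_self]
      rw [AddValuation.map_mul, val_pow_int vL this]
      simpa using h2
    · rw [AddValuation.map_mul, huv]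
      simpa using h1
  rw [hsum]
  generalize (σ z / z) ^ p * (σ u - u) + ((σ z / z) ^ p - 1) * u = w at hin
  by_cases hw : w = 0
  · rw [hw, mul_zero, AddValuation.map_zero]
    exact WithTop.coe_lt_top _
  obtain ⟨m, hm⟩ := exists_int_val vL hw
  rw [hm, WithTop.coe_lt_coe] at hin
  rw [val_mul_int vL hzp hm, WithTop.coe_lt_coe]
  omega

end SingleBreak

end Galois


/-! ### Binomial coefficients of degree less than `p` in characteristic `p` -/

section Binomial

variable {F : Type*} [Field F]

@[simp]
theorem fieldBinom_zero_right (x : F) : fieldBinom x 0 = 1 := by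
  simp [fieldBinom]

theorem fieldBinom_eq_smeval (x : F) (k : ℕ) :
    fieldBinom x k = (descPochhammer ℤ k).smeval x / (k.factorial : F) := by
  rw [fieldBinom, ← descPochhammer_eval_eq_prod_range, ← Polynomial.aeval_eq_smeval,
    Polynomial.aeval_def, Polynomial.eval₂_eq_eval_map, descPochhammer_map]

theorem factorial_ne_zero_of_lt (p : ℕ) [Fact p.Prime] [CharP F p] {k : ℕ} (hk : k < p) :
    (k.factorial : F) ≠ 0 := by
  rw [Ne, CharP.cast_eq_zero_iff F p, (Fact.out : p.Prime).dvd_factorial]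
  omega

/-- The Chu–Vandermonde identity. -/
theorem fieldBinom_add (p : ℕ) [Fact p.Prime] [CharP F p] (x y : F) {k : ℕ} (hk : k < p) :
    fieldBinom (x + y) k = ∑ m ∈ Finset.range (k + 1), fieldBinom x m * fieldBinom y (k - m) := by
  have h := Ring.descPochhammer_smeval_add k (Commute.all x y)
  rw [Finset.Nat.sum_antidiagonal_eq_sum_range_succ_mk] at h
  rw [fieldBinom_eq_smeval, h, Finset.sum_div]
  refine Finset.sum_congr rfl fun m hm => ?_
  rw [Finset.mem_range] at hm
  have hmk : m ≤ k := by omega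
  rw [fieldBinom_eq_smeval, fieldBinom_eq_smeval]
  have h1 := factorial_ne_zero_of_lt (F := F) p hk
  have h2 := factorial_ne_zero_of_lt (F := F) p (show m < p by omega)
  have h3 := factorial_ne_zero_of_lt (F := F) p (show k - m < p by omega)
  have h4 : ((k.choose m : ℕ) : F) * m.factorial * (k - m).factorial = k.factorial := by
    exact_mod_cast congrArg (Nat.cast (R := F)) (Nat.choose_mul_factorial_mul_factorial hmk)
  rw [div_mul_div_comm, div_eq_div_iff h1 (mul_ne_zero h2 h3), ← h4]
  ring

theorem fieldBinom_add_one (p : ℕ) [Fact p.Prime] [CharP F p] (x : F) {k : ℕ} (hk : k + 1 < p) :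
    fieldBinom (x + 1) (k + 1) = fieldBinom x (k + 1) + fieldBinom x k := by
  have h1 := factorial_ne_zero_of_lt (F := F) p hk
  have h2 := factorial_ne_zero_of_lt (F := F) p (show k < p by omega)
  have hk1 : ((k : F) + 1) ≠ 0 := by
    have : ((k + 1 : ℕ) : F) ≠ 0 := by
      intro h
      rw [Nat.factorial_succ, Nat.cast_mul, h, zero_mul] at h1
      exact h1 rfl
    exact_mod_cast this
  have e1 : ∏ j ∈ Finset.range (k + 1), (x + 1 - (j : F)) =
      (x + 1) * ∏ j ∈ Finset.range k, (x - (j : F)) := by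
    rw [Finset.prod_range_succ', mul_comm]
    congr 1
    · simp
    · refine Finset.prod_congr rfl fun j _ => ?_
      push_cast; ring
  rw [fieldBinom, fieldBinom, fieldBinom, e1, Finset.prod_range_succ, Nat.factorial_succ]
  push_cast
  field_simp
  ring

theorem map_fieldBinom {E : Type*} [Field E] (f : F →+* E) (x : F) (k : ℕ) :
    f (fieldBinom x k) = fieldBinom (f x) k := by
  simp [fieldBinom, map_prod, map_div₀]

end Binomial


/-! ### Group ring elements acting as translations -/

section Translation

variable {F K L : Type*} [Field F] [Field K] [Field L] [Algebra F K] [Algebra K L]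

/-- The action of `F[G]` on `L`. -/
noncomputable def coeffAction : MonoidAlgebra F Gal(L/K) →+* Module.End K L :=
  (galAction (K := K) (L := L)).toRingHom.comp
    (MonoidAlgebra.mapRingHom Gal(L/K) (algebraMap F K))

theorem coeffAction_apply (z : MonoidAlgebra F Gal(L/K)) :
    coeffAction z = galAction (MonoidAlgebra.mapRingHom Gal(L/K) (algebraMap F K) z) := rfl

theorem coeffAction_of (σ : Gal(L/K)) (y : L) :
    coeffAction (MonoidAlgebra.of F Gal(L/K) σ) y = σ y := by
  rw [coeffAction_apply, MonoidAlgebra.of_apply, MonoidAlgebra.mapRingHom_single,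
    galAction_single, map_one, one_smul]

theorem coeffAction_smul (c : F) (z : MonoidAlgebra F Gal(L/K)) (y : L) :
    coeffAction (c • z) y = algebraMap K L (algebraMap F K c) * coeffAction z y := by
  have h : c • z = MonoidAlgebra.single 1 c * z := by
    ext g
    simp
  rw [h, map_mul, Module.End.mul_apply, coeffAction_apply (MonoidAlgebra.single 1 c),
    MonoidAlgebra.mapRingHom_single, galAction_single, Algebra.smul_def]
  rfl

variable {n : ℕ}

variable (F K) in
/-- The constants of `F`, inside `L`. -/
def coeffHom (L : Type*) [Field L] [Algebra K L] : F →+* L :=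
  (algebraMap K L).comp (algebraMap F K)

theorem galois_coeffHom (σ : Gal(L/K)) (c : F) : σ (coeffHom F K L c) = coeffHom F K L c := by
  simp [coeffHom]

/-- The product of the binomial coefficients `binom(X_i, f_i)`. -/
noncomputable def binomProd (X : Fin n → L) (f : Fin n → ℕ) : L :=
  ∏ i, fieldBinom (X i) (f i)

/-- `Θ ∈ F[G]` acts on the functions of `X` of degree less than `p` in each variable as the
translation by `t`. -/
def IsTranslation (p : ℕ) (X : Fin n → L) (Θ : MonoidAlgebra F Gal(L/K)) (t : Fin n → F) : Prop :=
  ∀ f : Fin n → ℕ, (∀ i, f i < p) → ∀ s : Fin n → F,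
    coeffAction Θ (binomProd (fun i => X i + coeffHom F K L (s i)) f) =
      binomProd (fun i => X i + coeffHom F K L (s i + t i)) f

variable {p : ℕ} {X : Fin n → L}

theorem isTranslation_of {σ : Gal(L/K)} {t : Fin n → F}
    (h : ∀ i, σ (X i) = X i + coeffHom F K L (t i)) :
    IsTranslation p X (MonoidAlgebra.of F Gal(L/K) σ) t := by
  intro f _ s
  rw [coeffAction_of, binomProd, binomProd, map_prod]
  refine Finset.prod_congr rfl fun i _ => ?_
  have := map_fieldBinom (σ : L →+* L) (X i + coeffHom F K L (s i)) (f i)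
  simp only [RingHom.coe_coe, map_add, h, galois_coeffHom] at this
  rw [this, map_add]
  congr 1
  ring

/-- Composition works because `IsTranslation` quantifies over every shift `s`: the second operator
meets functions that are already translated. -/
theorem IsTranslation.mul {Θ Θ' : MonoidAlgebra F Gal(L/K)} {t t' : Fin n → F}
    (h : IsTranslation p X Θ t) (h' : IsTranslation p X Θ' t') :
    IsTranslation p X (Θ * Θ') (t + t') := by
  intro f hf s
  rw [map_mul, Module.End.mul_apply, h' f hf s, h f hf]
  simp only [Pi.add_apply]
  congr 1
  funext i
  rw [add_assoc, add_comm (t' i)]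

theorem binomProd_update (X : Fin n → L) (f : Fin n → ℕ) (k : Fin n) (m : ℕ) :
    binomProd X (Function.update f k m) =
      fieldBinom (X k) m * ∏ i ∈ Finset.univ.erase k, fieldBinom (X i) (f i) := by
  rw [binomProd, ← Finset.mul_prod_erase _ _ (Finset.mem_univ k), Function.update_self]
  congr 1
  refine Finset.prod_congr rfl fun i hi => ?_
  rw [Function.update_of_ne (Finset.ne_of_mem_erase hi)]

theorem binomProd_eq_mul (X : Fin n → L) (f : Fin n → ℕ) (k : Fin n) :
    binomProd X f =
      fieldBinom (X k) (f k) * ∏ i ∈ Finset.univ.erase k, fieldBinom (X i) (f i) := by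
  rw [← binomProd_update, Function.update_eq_self]

theorem binomProd_translate (X : Fin n → L) (f : Fin n → ℕ) (s : Fin n → F) (k : Fin n) (c : F) :
    binomProd (fun i => X i + coeffHom F K L (s i + (Pi.single k c : Fin n → F) i)) f =
      fieldBinom (X k + coeffHom F K L (s k) + coeffHom F K L c) (f k) *
        ∏ i ∈ Finset.univ.erase k, fieldBinom (X i + coeffHom F K L (s i)) (f i) := by
  rw [binomProd_eq_mul _ _ k]
  simp only [Pi.single_eq_same, map_add, add_assoc]
  congr 1
  refine Finset.prod_congr rfl fun i hi => ?_
  rw [Pi.single_eq_of_ne (Finset.ne_of_mem_erase hi), map_zero, add_zero]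

theorem mk_truncPow {G : Type*} [Group G] (c : F) (x : MonoidAlgebra F G) :
    (Ideal.Quotient.mk (augIdeal F G ^ p) (RefinedBreaks.truncPow p c x) : Rbar F G p) =
      RefinedBreaks.truncPow p c (Ideal.Quotient.mk (augIdeal F G ^ p) x : Rbar F G p) := by
  simp only [RefinedBreaks.truncPow, map_sum]
  refine Finset.sum_congr rfl fun i _ => ?_
  rw [← map_one (Ideal.Quotient.mk (augIdeal F G ^ p)), ← map_sub, ← map_pow]
  rfl

variable [Fact p.Prime] [CharP L p]

/-- A forward difference in the variable `X k`, evaluated by Pascal's rule. -/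
theorem IsTranslation.sub_one_apply {Θ : MonoidAlgebra F Gal(L/K)} {k : Fin n}
    (h : IsTranslation p X Θ (Pi.single k 1)) {f : Fin n → ℕ} (hf : ∀ i, f i < p)
    (s : Fin n → F) :
    coeffAction (Θ - 1) (binomProd (fun i => X i + coeffHom F K L (s i)) f) =
      if 1 ≤ f k then
        binomProd (fun i => X i + coeffHom F K L (s i)) (Function.update f k (f k - 1))
      else 0 := by
  rw [map_sub, map_one, LinearMap.sub_apply, Module.End.one_apply, h f hf s,
    binomProd_translate, binomProd_eq_mul _ f k, map_one, ← sub_mul]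
  split_ifs with hk
  · rw [binomProd_update]
    have hfk := hf k
    obtain ⟨m, hm⟩ := Nat.exists_eq_add_of_le' hk
    rw [hm] at hfk ⊢
    rw [fieldBinom_add_one p _ hfk, add_sub_cancel_left, Nat.add_sub_cancel]
  · rw [show f k = 0 by omega]
    simp

theorem IsTranslation.sub_one_pow_apply {Θ : MonoidAlgebra F Gal(L/K)} {k : Fin n}
    (h : IsTranslation p X Θ (Pi.single k 1)) {f : Fin n → ℕ} (hf : ∀ i, f i < p)
    (s : Fin n → F) (m : ℕ) :
    coeffAction ((Θ - 1) ^ m) (binomProd (fun i => X i + coeffHom F K L (s i)) f) =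
      if m ≤ f k then
        binomProd (fun i => X i + coeffHom F K L (s i)) (Function.update f k (f k - m))
      else 0 := by
  induction m with
  | zero => simp
  | succ m ih =>
    rw [pow_succ', map_mul, Module.End.mul_apply, ih]
    by_cases hm : m ≤ f k
    · rw [if_pos hm, h.sub_one_apply]
      · simp only [Function.update_self, Function.update_idem]
        by_cases hm' : m + 1 ≤ f k
        · rw [if_pos hm', if_pos (by omega), Nat.sub_sub]
        · rw [if_neg hm', if_neg (by omega)]
      · intro i
        by_cases hi : i = k
        · subst hi
          rw [Function.update_self]
          exact lt_of_le_of_lt (Nat.sub_le _ _) (hf i)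
        · rw [Function.update_of_ne hi]
          exact hf i
    · rw [if_neg hm, if_neg (by omega), map_zero]

/-- Since `(Θ - 1) ^ m` lowers the index `f k` by `m`, the truncated power produces the Vandermonde
expansion of `binom(X_k + c, f k)`. -/
theorem IsTranslation.truncPow {Θ : MonoidAlgebra F Gal(L/K)} {k : Fin n}
    (h : IsTranslation p X Θ (Pi.single k 1)) (c : F) :
    IsTranslation p X (truncPow p c Θ) (Pi.single k c) := by
  intro f hf s
  have hfk := hf k
  rw [RefinedBreaks.truncPow, map_sum, LinearMap.sum_apply, binomProd_translate,
    add_comm (X k + _), fieldBinom_add p _ _ hfk, Finset.sum_mul]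
  -- Truncation at `p` loses nothing: the terms with `m > f k` vanish and `f k < p`.
  rw [← Finset.sum_subset (Finset.range_subset_range.mpr (show f k + 1 ≤ p from hfk))]
  · refine Finset.sum_congr rfl fun m hm => ?_
    rw [Finset.mem_range] at hm
    rw [coeffAction_smul, h.sub_one_pow_apply hf, if_pos (by omega), binomProd_update,
      ← map_fieldBinom, mul_assoc]
    rfl
  · intro m _ hm
    rw [Finset.mem_range] at hm
    rw [coeffAction_smul, h.sub_one_pow_apply hf, if_neg (by omega), mul_zero]

/-- If `G` acts on `X` by unitriangular translations, then the unit translations are realized by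
elements of `F[G]` whose images lie in the truncated span of `G`. -/
theorem exists_isTranslation_single {τ : Fin n → Gal(L/K)} {M : Fin n → Fin n → F}
    (hτ : ∀ i j, τ j (X i) = X i + coeffHom F K L (M i j)) (hdiag : ∀ i, M i i = 1)
    (htri : ∀ i j, i < j → M i j = 0) (k : Fin n) :
    ∃ Θ : MonoidAlgebra F Gal(L/K), IsTranslation p X Θ (Pi.single k 1) ∧
      InTruncSpan F Gal(L/K) p (Ideal.Quotient.mk _ Θ) := by
  let Q : (Fin n → F) → Prop := fun t => ∃ Θ : MonoidAlgebra F Gal(L/K), IsTranslation p X Θ t ∧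
      InTruncSpan F Gal(L/K) p (Ideal.Quotient.mk _ Θ)
  have hadd : ∀ t t', Q t → Q t' → Q (t + t') := by
    rintro t t' ⟨Θ, h1, h2⟩ ⟨Θ', h1', h2'⟩
    refine ⟨Θ * Θ', h1.mul h1', ?_⟩
    rw [map_mul]
    exact h2.mul h2'
  have hzero : Q 0 := ⟨MonoidAlgebra.of F _ 1, isTranslation_of (by simp), .of 1⟩
  have hsmul : ∀ (c : F) (i : Fin n), Q (Pi.single i 1) → Q (Pi.single i c) := by
    rintro c i ⟨Θ, h1, h2⟩
    refine ⟨RefinedBreaks.truncPow p c Θ, h1.truncPow c, ?_⟩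
    rw [mk_truncPow]
    exact h2.pow c
  change Q (Pi.single k 1)
  -- Back substitution from the largest index: column `k` of `M` is the `k`-th unit vector plus
  -- multiples of unit vectors of larger index, which the induction hypothesis and truncated powers
  -- remove.
  induction k using WellFoundedGT.induction with
  | ind k ih =>
    have hcol : Q (fun i => M i k) :=
      ⟨MonoidAlgebra.of F _ (τ k), isTranslation_of fun i => hτ i k, .of _⟩
    have hsum : Q (∑ j ∈ Finset.univ.filter (k < ·), Pi.single j (-M j k)) :=
      Finset.sum_induction _ Q hadd hzero fun j hj =>
        hsmul _ _ (ih j (Finset.mem_filter.mp hj).2)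
    convert hadd _ _ hcol hsum using 1
    funext i
    rw [Pi.add_apply, Finset.sum_apply]
    simp only [Pi.single_apply, Finset.sum_ite_eq, Finset.mem_filter, Finset.mem_univ, true_and]
    rcases lt_trichotomy i k with h | h | h
    · rw [if_neg h.ne, if_neg h.not_gt, htri i k h, add_zero]
    · subst h
      simp [hdiag]
    · rw [if_neg h.ne', if_pos h, add_neg_cancel]

end Translation


/-! ### Elimination among Artin–Schreier generators -/

section ArtinSchreier

variable {F K L : Type*} [Field F] [Field K] [Field L] [Algebra F K] [Algebra K L]
  {vK : AddValuation K (WithTop ℤ)} {vL : AddValuation L (WithTop ℤ)}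

theorem val_coeffHom [FiniteDimensional K L] (hK : IsLocalField F vK)
    (hL : IsTotallyRamified vK vL) {c : F} (hc : c ≠ 0) :
    vL (coeffHom F K L c) = ((0 : ℤ) : WithTop ℤ) := by
  have h : vK (algebraMap F K c) = ((0 : ℤ) : WithTop ℤ) := by simpa using hK.map_coeff c hc
  rw [coeffHom, RingHom.comp_apply, hL.val_base h, mul_zero]

theorem lt_val_coeffHom_mul [FiniteDimensional K L] (hK : IsLocalField F vK)
    (hL : IsTotallyRamified vK vL) (c : F) {y : L} {k : ℤ} (hy : (k : WithTop ℤ) < vL y) :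
    (k : WithTop ℤ) < vL (coeffHom F K L c * y) := by
  by_cases hc : c = 0
  · simp [hc]
  · rw [AddValuation.map_mul, val_coeffHom hK hL hc]
    simpa using hy

/-- In an elementary abelian extension of full degree generated by Artin–Schreier roots, the
roots can be translated independently. -/
theorem exists_galois_translation {p n : ℕ} [Fact p.Prime] [CharP L p] [FiniteDimensional K L]
    (hcard : Nat.card Gal(L/K) = p ^ n) {x : Fin n → L} {a : Fin n → K}
    (hx : ∀ i, x i ^ p - x i = algebraMap K L (a i))
    (hgen : IntermediateField.adjoin K (Set.range x) = ⊤) :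
    ∃ τ : Fin n → Gal(L/K), ∀ i j, τ j (x i) = x i + if i = j then 1 else 0 := by
  have hp : 0 < p := (Fact.out : p.Prime).pos
  have hex : ∀ (σ : Gal(L/K)) (i : Fin n), ∃ m : ℕ, m < p ∧ σ (x i) = x i + m := by
    intro σ i
    -- The difference of two roots of one Artin–Schreier equation lies in the prime field.
    have h : (σ (x i) - x i) ^ p = σ (x i) - x i := by
      have h1 := congrArg σ (hx i)
      rw [AlgEquiv.commutes, ← hx i, map_sub, map_pow] at h1
      rw [sub_pow_char]
      linear_combination h1
    rw [← Subfield.mem_bot_iff_pow_eq_self L p, ← ZMod.fieldRange_castHom_eq_bot p] at h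
    obtain ⟨z, hz⟩ := h
    refine ⟨z.val, z.val_lt, ?_⟩
    rw [ZMod.castHom_apply, ZMod.cast_eq_val] at hz
    rw [hz]
    ring
  choose m hmp hm using hex
  let f : Gal(L/K) → Fin n → Fin p := fun σ i => ⟨m σ i, hmp σ i⟩
  have hf : Function.Injective f := by
    intro σ σ' h
    have hxx : ∀ i, σ (x i) = σ' (x i) := by
      intro i
      have := congrArg Fin.val (congrFun h i)
      simp only [f] at this
      rw [hm, hm, this]
    have h2 : (σ : L →ₐ[K] L) = σ' := by
      refine AlgHom.ext fun y => ?_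
      have hy : y ∈ IntermediateField.adjoin K (Set.range x) := hgen ▸ IntermediateField.mem_top
      induction hy using IntermediateField.adjoin_induction with
      | mem z hz =>
        obtain ⟨i, rfl⟩ := hz
        exact hxx i
      | algebraMap z => simp
      | add z w _ _ hz hw => rw [map_add, map_add, hz, hw]
      | inv z _ hz => rw [map_inv₀, map_inv₀, hz]
      | mul z w _ _ hz hw => rw [map_mul, map_mul, hz, hw]
    exact AlgEquiv.coe_toAlgHom_injective h2
  -- Both sides have `p ^ n` elements, so every vector of translations over the prime field occurs.
  have hbij := hf.bijective_of_nat_card_le (by rw [hcard]; simp)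
  choose τ hτ using fun j : Fin n => hbij.2
    (fun i => ⟨if i = j then 1 else 0, by split_ifs; exacts [(Fact.out : p.Prime).one_lt, hp]⟩)
  refine ⟨τ, fun i j => ?_⟩
  have := congrArg Fin.val (congrFun (hτ j) i)
  simp only [f] at this
  rw [hm, this]
  split_ifs <;> simp

/-- The generators of `L / K` obtained from the roots `x i` by successive elimination. -/
theorem exists_unitriangular_generators {p n b : ℕ} [Fact p.Prime] [CharP F p] [CharP L p]
    [PerfectField F] [FiniteDimensional K L] (hK : IsLocalField F vK)
    (hL : IsTotallyRamified vK vL) (hb : 0 < b)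
    (hbreak : ramificationBreaks K vL = {(b : ℤ)})
    {τ : Fin n → Gal(L/K)} {x : Fin n → L} {a₀ : Fin n → F} {Y₀ : L} {e₀ : Fin n → L}
    (hτ : ∀ i j, τ j (x i) = x i + if i = j then 1 else 0)
    (hx : ∀ i, x i ^ p - x i = coeffHom F K L (a₀ i) * Y₀ + e₀ i)
    (hY₀ : vL Y₀ = ((-(b * p ^ n) : ℤ) : WithTop ℤ))
    (he₀ : ∀ i, ((-(b * p) : ℤ) : WithTop ℤ) < vL (e₀ i)) :
    ∃ (X : Fin n → L) (M : Fin n → Fin n → F),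
      (∀ i j, τ j (X i) = X i + coeffHom F K L (M i j)) ∧ (∀ i, M i i = 1) ∧
      (∀ i j, i < j → M i j = 0) ∧
      ∀ i, vL (X i) = ((-(b * p ^ (n - (i + 1))) : ℤ) : WithTop ℤ) := by
  have hp : 1 < p := (Fact.out : p.Prime).one_lt
  have hp0 : (0 : ℤ) < p := by omega
  have hbz : (0 : ℤ) < b := by exact_mod_cast hb
  have := PerfectField.toPerfectRing (K := F) p
  -- State after `l` eliminations: generators of index below `l` are final, and the others share the
  -- leading element `Y`, with error terms still above `-b * p`.
  suffices h : ∀ l : ℕ, l ≤ n → ∃ (y : Fin n → L) (M : Fin n → Fin n → F) (a : Fin n → F) (Y : L)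
      (e : Fin n → L), (∀ i j, τ j (y i) = y i + coeffHom F K L (M i j)) ∧ (∀ i, M i i = 1) ∧
      (∀ i j, i < j → M i j = 0) ∧
      (∀ i : Fin n, (i : ℕ) < l → vL (y i) = ((-(b * p ^ (n - (i + 1))) : ℤ) : WithTop ℤ)) ∧
      (∀ i : Fin n, l ≤ (i : ℕ) → y i ^ p - y i = coeffHom F K L (a i) * Y + e i) ∧
      vL Y = ((-(b * p ^ (n - l)) : ℤ) : WithTop ℤ) ∧
      ∀ i, ((-(b * p) : ℤ) : WithTop ℤ) < vL (e i) by
    obtain ⟨y, M, -, -, -, h1, h2, h3, h4, -⟩ := h n le_rfl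
    exact ⟨y, M, h1, h2, h3, fun i => h4 i i.isLt⟩
  intro l
  induction l with
  | zero =>
    intro _
    refine ⟨x, fun i j => if i = j then 1 else 0, a₀, Y₀, e₀, fun i j => ?_, by simp,
      fun i j hij => if_neg hij.ne, by simp, fun i _ => hx i, hY₀, he₀⟩
    rw [hτ]
    beta_reduce
    split_ifs <;> simp
  | succ l ih =>
    intro hl
    obtain ⟨y, M, a, Y, e, hy, hdiag, htri, hval, hAS, hY, he⟩ := ih (by omega)
    let k : Fin n := ⟨l, hl⟩
    have hASk := hAS k le_rfl
    -- A zero pivot would leave only the error, so `v_L(y_k) > -b`; then `τ k` would move `y k` by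
    -- an element of positive valuation, whereas it moves it by `1`.
    have hak : a k ≠ 0 := by
      intro h0
      rw [h0, map_zero, zero_mul, zero_add] at hASk
      have h1 : ((-b : ℤ) : WithTop ℤ) < vL (y k) := by
        apply lt_val_of_lt_val_pow_sub vL hp _ (by omega)
        rw [hASk]
        convert he k using 2
        ring
      have h2 := add_le_val_galois_sub hL hbreak (τ k) (y k)
      rw [hy, hdiag, map_one, add_sub_cancel_left, AddValuation.map_one] at h2
      have hyk : y k ≠ 0 := by
        intro h
        rw [h, AddValuation.map_zero] at h2
        simp at h2
      obtain ⟨m, hm⟩ := exists_int_val vL hyk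
      rw [hm, WithTop.coe_lt_coe] at h1
      rw [hm] at h2
      have : m + (b : ℤ) ≤ 0 := by exact_mod_cast h2
      omega
    have hpow : ∀ m : ℕ, (1 : ℤ) ≤ (p : ℤ) ^ m := fun m => one_le_pow₀ (by omega)
    have hnl : n - l = n - (l + 1) + 1 := by omega
    have hmain : vL (coeffHom F K L (a k) * Y) =
        ((p * -(b * p ^ (n - (l + 1))) : ℤ) : WithTop ℤ) := by
      rw [val_mul_int vL (val_coeffHom hK hL hak) hY, hnl]
      congr 1
      ring
    -- The leading term has valuation at most `-b * p`, hence dominates the error, and the root has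
    -- one `p`-th of its valuation.
    have hyk : vL (y k) = ((-(b * p ^ (n - (l + 1))) : ℤ) : WithTop ℤ) := by
      apply val_pow_eq_of_lt vL hp
      · rw [hASk, AddValuation.map_add_eq_of_lt_left, hmain]
        refine lt_of_le_of_lt ?_ (he k)
        rw [hmain, WithTop.coe_le_coe]
        nlinarith [mul_pos hbz hp0, hpow (n - (l + 1))]
      · nlinarith [hpow (n - (l + 1))]
    let d : Fin n → F := fun i => if l < (i : ℕ) then (frobeniusEquiv F p).symm (a i / a k) else 0
    have hd : ∀ i : Fin n, l < (i : ℕ) → d i ^ p * a k = a i := by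
      intro i hi
      have : d i ^ p = a i / a k := by
        simp only [d, if_pos hi]
        exact frobeniusEquiv_symm_pow_p F p _
      rw [this, div_mul_cancel₀ _ hak]
    have hd0 : ∀ i : Fin n, ¬ l < (i : ℕ) → d i = 0 := fun i hi => if_neg hi
    -- As `d i ^ p * a k = a i`, the terms in `Y` cancel. Replacing `y k ^ p` by `y k` plus its
    -- right side leaves `(d i - d i ^ p) * y k`, so `y k` is the next leading element. `M`
    -- undergoes the same row operation.
    refine ⟨fun i => y i - coeffHom F K L (d i) * y k, fun i j => M i j - d i * M k j,
      fun i => d i - d i ^ p, y k, fun i => e i - coeffHom F K L (d i ^ p) * e k, ?_, ?_, ?_, ?_,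
      ?_, hyk, ?_⟩
    · intro i j
      rw [map_sub, map_mul, galois_coeffHom, hy, hy, map_sub, map_mul]
      ring
    · intro i
      beta_reduce
      by_cases hi : l < (i : ℕ)
      · rw [htri k i hi, mul_zero, sub_zero, hdiag]
      · rw [hd0 i hi, zero_mul, sub_zero, hdiag]
    · intro i j hij
      beta_reduce
      by_cases hi : l < (i : ℕ)
      · rw [htri k j (lt_trans (Fin.lt_def.mpr hi) hij), htri i j hij, mul_zero, sub_zero]
      · rw [hd0 i hi, zero_mul, sub_zero, htri i j hij]
    · intro i hi
      beta_reduce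
      rw [hd0 i (by omega), map_zero, zero_mul, sub_zero]
      rcases Nat.lt_succ_iff_lt_or_eq.mp hi with h | h
      · exact hval i h
      · have : i = k := Fin.ext h
        subst this
        exact hyk
    · intro i hi
      have h1 := hAS i (by omega)
      have h2 : coeffHom F K L (a i) = coeffHom F K L (d i) ^ p * coeffHom F K L (a k) := by
        rw [← map_pow, ← map_mul, hd i hi]
      have h3 : coeffHom F K L (d i ^ p) = coeffHom F K L (d i) ^ p := map_pow _ _ _
      beta_reduce
      rw [sub_pow_char, mul_pow, map_sub, h3]
      rw [h2] at h1
      linear_combination h1 - coeffHom F K L (d i) ^ p * hASk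
    · intro i
      beta_reduce
      rw [sub_eq_add_neg]
      apply AddValuation.map_lt_add _ (he i)
      rw [AddValuation.map_neg]
      exact lt_val_coeffHom_mul hK hL _ (he k)

end ArtinSchreier


/-! ### Base `p` digits of `𝔞(w)` -/

section Digits

theorem sum_digits_eq_mod (p a n : ℕ) :
    ∑ j ∈ Finset.range n, a / p ^ j % p * p ^ j = a % p ^ n := by
  induction n with
  | zero => simp [Nat.mod_one]
  | succ n ih => rw [Finset.sum_range_succ, ih, Nat.mod_pow_succ, mul_comm]

theorem sum_rev_digits (p a n : ℕ) (ha : a < p ^ n) :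
    ∑ i : Fin n, a / p ^ (n - (i + 1)) % p * p ^ (n - ((i : ℕ) + 1)) = a := by
  conv_rhs => rw [← Nat.mod_eq_of_lt ha, ← sum_digits_eq_mod, ← Finset.sum_range_reflect,
    Finset.sum_range]
  refine Finset.sum_congr rfl fun i _ => ?_
  rw [show n - 1 - (i : ℕ) = n - (i + 1) by omega]

theorem pow_le_of_digit_pos {p a j : ℕ} (h : 1 ≤ a / p ^ j % p) : p ^ j ≤ a := by
  by_contra! hlt
  rw [Nat.div_eq_of_lt hlt] at h
  simp at h

/-- No borrow occurs because the `j`-th digit is positive. -/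
theorem digit_sub_pow {p a j : ℕ} (hp : 0 < p) (h : 1 ≤ a / p ^ j % p) (i : ℕ) :
    (a - p ^ j) / p ^ i % p = if i = j then a / p ^ j % p - 1 else a / p ^ i % p := by
  have hpj : 0 < p ^ j := pow_pos hp j
  have hle := pow_le_of_digit_pos h
  set q := a / p ^ j / p with hq
  set r := a % p ^ j with hr
  obtain ⟨d, hd⟩ := Nat.exists_eq_add_of_le' h
  have hdp : d + 1 < p := hd ▸ Nat.mod_lt _ hp
  have hrlt : r < p ^ j := Nat.mod_lt _ hpj
  -- Here `r` holds the digits below `j`, `d + 1` is the digit at `j`, and `q` holds those above.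
  have ha : a = r + p ^ j * (d + 1 + p * q) := by
    rw [← hd, hq, Nat.mod_add_div, hr, Nat.mod_add_div]
  clear_value r q
  have ha' : a - p ^ j = r + p ^ j * (d + p * q) := by
    rw [ha, show d + 1 + p * q = d + p * q + 1 by ring, mul_add, mul_one]
    omega
  rcases lt_trichotomy i j with hij | rfl | hij
  · rw [if_neg hij.ne]
    obtain ⟨k, rfl⟩ := Nat.exists_eq_add_of_lt hij
    have hpi : 0 < p ^ i := pow_pos hp i
    rw [ha']
    conv_rhs => rw [ha]
    have e : ∀ m, (r + p ^ (i + k + 1) * m) / p ^ i % p = r / p ^ i % p := by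
      intro m
      rw [show p ^ (i + k + 1) * m = p ^ i * (p * (p ^ k * m)) by ring,
        Nat.add_mul_div_left _ _ hpi, Nat.add_mul_mod_self_left]
    rw [e, e]
  · rw [if_pos rfl, hd, ha', Nat.add_mul_div_left _ _ hpj, Nat.div_eq_of_lt hrlt, zero_add,
      Nat.add_mul_mod_self_left, Nat.mod_eq_of_lt (by omega), Nat.add_sub_cancel]
  · rw [if_neg hij.ne']
    obtain ⟨k, rfl⟩ := Nat.exists_eq_add_of_lt hij
    have e : ∀ m, m < p → (r + p ^ j * (m + p * q)) / p ^ (j + k + 1) % p = q / p ^ k % p := by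
      intro m hm
      rw [show p ^ (j + k + 1) = p ^ j * (p * p ^ k) by ring, ← Nat.div_div_eq_div_mul,
        Nat.add_mul_div_left _ _ hpj, Nat.div_eq_of_lt hrlt, zero_add, ← Nat.div_div_eq_div_mul,
        Nat.add_mul_div_left _ _ hp, Nat.div_eq_of_lt hm, zero_add]
    rw [ha', e _ (by omega)]
    conv_rhs => rw [ha]
    rw [e _ hdp]

variable {p n b : ℕ}

theorem b_mul_frakA (hcop : b.Coprime p) (w : ℤ) :
    (b : ZMod (p ^ n)) * frakA p n b w = -w := by
  have h : (b : ZMod (p ^ n)) * (b : ZMod (p ^ n))⁻¹ = 1 :=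
    ZMod.coe_mul_inv_eq_one b (hcop.pow_right n)
  rw [frakA]
  linear_combination -(w : ZMod (p ^ n)) * h

/-- This makes the division in the exponent of `scaffoldElement` exact. -/
theorem pow_dvd_add_mul_frakA [NeZero p] (hcop : b.Coprime p) (w : ℤ) :
    ((p : ℤ) ^ n) ∣ w + b * (frakA p n b w).val := by
  have h := b_mul_frakA (n := n) hcop w
  rw [← Nat.cast_pow, ← ZMod.intCast_zmod_eq_zero_iff_dvd]
  push_cast
  rw [ZMod.natCast_zmod_val, h, add_neg_cancel]

theorem frakA_congr {w₁ w₂ : ℤ} (h : w₁ ≡ w₂ [ZMOD (p : ℤ) ^ n]) :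
    frakA p n b w₁ = frakA p n b w₂ := by
  rw [← Nat.cast_pow] at h
  rw [frakA, frakA, (ZMod.intCast_eq_intCast_iff _ _ _).mpr h]

theorem frakA_add (hcop : b.Coprime p) (w : ℤ) (j : ℕ) :
    frakA p n b (w + (p : ℤ) ^ j * b) = frakA p n b w - ((p ^ j : ℕ) : ZMod (p ^ n)) := by
  have h : (b : ZMod (p ^ n)) * (b : ZMod (p ^ n))⁻¹ = 1 :=
    ZMod.coe_mul_inv_eq_one b (hcop.pow_right n)
  rw [frakA, frakA]
  push_cast
  linear_combination -(p : ZMod (p ^ n)) ^ j * h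

theorem frakA_add_val [NeZero p] (hcop : b.Coprime p) {w : ℤ} {j : ℕ}
    (h : 1 ≤ digitA p n b w j) :
    (frakA p n b (w + (p : ℤ) ^ j * b)).val = (frakA p n b w).val - p ^ j := by
  have hle := pow_le_of_digit_pos h
  have hlt := (frakA p n b w).val_lt
  rw [frakA_add hcop]
  conv_lhs => rw [← ZMod.natCast_zmod_val (frakA p n b w)]
  rw [← Nat.cast_sub hle, ZMod.val_natCast, Nat.mod_eq_of_lt (by omega)]

end Digits

/-! ### The scaffold built from the generators -/

section Scaffold

variable {F K L : Type*} [Field F] [Field K] [Field L] [Algebra F K] [Algebra K L]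
  {vK : AddValuation K (WithTop ℤ)} {vL : AddValuation L (WithTop ℤ)} {p : ℕ}

/-- Negative valuation of `x` gives every factor `x - j` the valuation of `x`, and `k!` is a unit
for `k < p`. -/
theorem val_fieldBinom [FiniteDimensional K L] [Fact p.Prime] [CharP F p]
    (hK : IsLocalField F vK) (hL : IsTotallyRamified vK vL) {x : L} {m : ℤ}
    (hx : vL x = (m : WithTop ℤ)) (hm : m < 0) {k : ℕ} (hk : k < p) :
    vL (fieldBinom x k) = ((k * m : ℤ) : WithTop ℤ) := by
  have hfact : vL (k.factorial : L) = ((0 : ℤ) : WithTop ℤ) := by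
    rw [← map_natCast (coeffHom F K L)]
    exact val_coeffHom hK hL (factorial_ne_zero_of_lt p hk)
  have hsub : ∀ j : ℕ, vL (x - j) = (m : WithTop ℤ) := by
    intro j
    rw [AddValuation.map_sub_eq_of_lt_left, hx]
    rw [hx]
    have : ((-1 : ℤ) : WithTop ℤ) < vL (coeffHom F K L (j : F) * 1) :=
      lt_val_coeffHom_mul hK hL _ (by rw [AddValuation.map_one]; exact_mod_cast neg_one_lt_zero)
    rw [mul_one, map_natCast] at this
    refine lt_of_le_of_lt ?_ this
    rw [WithTop.coe_le_coe]
    omega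
  have hprod : vL (∏ j ∈ Finset.range k, (x - (j : L))) = ((k * m : ℤ) : WithTop ℤ) := by
    clear hk hfact
    induction k with
    | zero => simp
    | succ k ih =>
      rw [Finset.prod_range_succ, val_mul_int vL ih (hsub k)]
      congr 1
      push_cast; ring
  rw [fieldBinom, val_div_int vL hprod hfact, sub_zero]

theorem val_prod_int {ι : Type*} (s : Finset ι) {x : ι → L} {k : ι → ℤ}
    (h : ∀ i ∈ s, vL (x i) = (k i : WithTop ℤ)) :
    vL (∏ i ∈ s, x i) = ((∑ i ∈ s, k i : ℤ) : WithTop ℤ) := by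
  classical
  induction s using Finset.induction_on with
  | empty => simp
  | insert a s ha ih =>
    rw [Finset.prod_insert ha, Finset.sum_insert ha]
    exact val_mul_int vL (h a (Finset.mem_insert_self a s))
      (ih fun i hi => h i (Finset.mem_insert_of_mem hi))

end Scaffold


section Scaffold

variable {F K L : Type*} [Field F] [Field K] [Field L] [Algebra F K] [Algebra K L]
  {vK : AddValuation K (WithTop ℤ)} {vL : AddValuation L (WithTop ℤ)} {p n b : ℕ}

/-- The element of valuation `w` of the scaffold attached to the generators `X` and the
uniformizer `t` of `K`. -/
noncomputable def scaffoldElement (p b : ℕ) (t : K) (X : Fin n → L) (w : ℤ) : L :=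
  algebraMap K L (t ^ ((w + b * (frakA p n b w).val) / (p : ℤ) ^ n)) *
    binomProd X fun i => digitA p n b w (n - (i + 1))

theorem val_scaffoldElement [FiniteDimensional K L] [Fact p.Prime] [CharP F p]
    (hK : IsLocalField F vK) (hL : IsTotallyRamified vK vL) (hrank : Module.finrank K L = p ^ n)
    (hb : 0 < b) (hcop : b.Coprime p) {X : Fin n → L}
    (hval : ∀ i, vL (X i) = ((-(b * p ^ (n - (i + 1))) : ℤ) : WithTop ℤ))
    {t : K} (ht : vK t = ((1 : ℤ) : WithTop ℤ)) (w : ℤ) :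
    vL (scaffoldElement p b t X w) = (w : WithTop ℤ) := by
  have hp : 0 < p := (Fact.out : p.Prime).pos
  have : NeZero p := ⟨hp.ne'⟩
  have hprod : vL (binomProd X fun i => digitA p n b w (n - (i + 1))) =
      ((∑ i : Fin n, (digitA p n b w (n - (i + 1)) : ℤ) * -(b * p ^ (n - (i + 1))) : ℤ) :
        WithTop ℤ) := by
    refine val_prod_int _ fun i _ => val_fieldBinom hK hL (hval i) ?_ (Nat.mod_lt _ hp)
    rw [neg_lt_zero]
    positivity
  rw [scaffoldElement, val_mul_int vL (hL.val_base (val_zpow_int vK ht _)) hprod, hrank]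
  congr 1
  -- The valuations of the generators are `-b` times the place values, so the digits reassemble
  -- `𝔞(w)`.
  have hsum : ∑ i : Fin n, (digitA p n b w (n - (i + 1)) : ℤ) * -(b * p ^ (n - (i + 1))) =
      -(b * (frakA p n b w).val) := by
    have h := sum_rev_digits p _ n (frakA p n b w).val_lt
    conv_rhs => rw [← h]
    push_cast
    rw [Finset.mul_sum, ← Finset.sum_neg_distrib]
    refine Finset.sum_congr rfl fun i _ => ?_
    rw [digitA]
    push_cast
    ring
  rw [hsum, mul_one, Nat.cast_pow, Int.mul_ediv_cancel' (pow_dvd_add_mul_frakA hcop w)]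
  ring

/-- Adding `p ^ j * b` to `w` lowers `𝔞(w)` by `p ^ j` without a borrow, so `w + b * 𝔞(w)`, and with
it the power of `t`, does not change. This is why the scaffold units are `1`. -/
theorem scaffoldElement_add [Fact p.Prime] (hcop : b.Coprime p) (t : K) (X : Fin n → L)
    {w : ℤ} {i : Fin n} (h : 1 ≤ digitA p n b w (n - (i + 1))) :
    scaffoldElement p b t X (w + (p : ℤ) ^ (n - (i + 1 : ℕ)) * b) =
      algebraMap K L (t ^ ((w + b * (frakA p n b w).val) / (p : ℤ) ^ n)) *
        binomProd X (Function.update (fun i => digitA p n b w (n - (i + 1))) i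
          (digitA p n b w (n - (i + 1)) - 1)) := by
  have hp : 0 < p := (Fact.out : p.Prime).pos
  have : NeZero p := ⟨hp.ne'⟩
  have hval := frakA_add_val hcop h
  rw [scaffoldElement]
  congr 3
  · rw [hval, Nat.cast_sub (pow_le_of_digit_pos h)]
    congr 1
    push_cast
    ring
  · funext k
    rw [digitA, hval, digit_sub_pow hp h]
    by_cases hk : k = i
    · subst hk
      rw [if_pos rfl, Function.update_self]
      rfl
    · rw [Function.update_of_ne hk, if_neg]
      · rfl
      · intro heq
        exact hk (Fin.ext (by omega))

/-- Elements of `F[G]` acting as unit translations of generators with valuations `-b p^(n-i)`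
define a Galois scaffold. -/
theorem isGaloisScaffold_of_isTranslation [FiniteDimensional K L] [Fact p.Prime] [CharP F p]
    [CharP L p] (hK : IsLocalField F vK) (hL : IsTotallyRamified vK vL)
    (hrank : Module.finrank K L = p ^ n) (hb : 0 < b) (hcop : b.Coprime p) {X : Fin n → L}
    (hval : ∀ i, vL (X i) = ((-(b * p ^ (n - (i + 1))) : ℤ) : WithTop ℤ))
    {Θ : Fin n → MonoidAlgebra F Gal(L/K)} (hΘ : ∀ k, IsTranslation p X (Θ k) (Pi.single k 1))
    {t : K} (ht : vK t = ((1 : ℤ) : WithTop ℤ)) :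
    IsGaloisScaffold vK vL p n b (scaffoldElement p b t X)
      (fun i => MonoidAlgebra.mapRingHom Gal(L/K) (algebraMap F K) (Θ i - 1)) (fun _ _ => 1) := by
  have hp : 0 < p := (Fact.out : p.Prime).pos
  have hv := val_scaffoldElement hK hL hrank hb hcop hval ht
  have hact : ∀ (k : Fin n) (f : Fin n → ℕ), (∀ i, f i < p) →
      coeffAction (Θ k - 1) (binomProd X f) =
        if 1 ≤ f k then binomProd X (Function.update f k (f k - 1)) else 0 := by
    intro k f hf
    simpa using (hΘ k).sub_one_apply hf 0
  refine ⟨hv, fun w₁ w₂ h => ?_, fun i => ?_, fun _ _ => AddValuation.map_one _, fun i w => ?_⟩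
  · have hne := ne_zero_of_val_eq_int vL (hv w₂)
    refine ⟨t ^ ((w₁ + b * (frakA p n b w₁).val) / (p : ℤ) ^ n) *
      (t ^ ((w₂ + b * (frakA p n b w₂).val) / (p : ℤ) ^ n))⁻¹, ?_⟩
    rw [scaffoldElement] at hne
    -- Congruent indices have the same digits, so the binomial products cancel in the quotient.
    simp only [scaffoldElement, digitA, frakA_congr h] at hne ⊢
    rw [map_mul, map_inv₀, mul_inv]
    have h2 := right_ne_zero_of_mul hne
    rw [mul_mul_mul_comm, mul_inv_cancel₀ h2, mul_one]
  -- The constant `1` is the binomial product with all indices zero.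
  · have h := hact i 0 fun _ => hp
    rw [if_neg (by simp)] at h
    rw [← coeffAction_apply]
    simpa [binomProd] using h
  · rw [← coeffAction_apply, map_one, one_mul]
    have h : coeffAction (Θ i - 1) (scaffoldElement p b t X w) =
        algebraMap K L (t ^ ((w + b * (frakA p n b w).val) / (p : ℤ) ^ n)) *
          coeffAction (Θ i - 1) (binomProd X fun i => digitA p n b w (n - (i + 1))) := by
      rw [scaffoldElement, ← Algebra.smul_def, map_smul, Algebra.smul_def]
    rw [h, hact i (fun i => digitA p n b w (n - (i + 1))) fun _ => Nat.mod_lt _ hp]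
    split_ifs with hd
    · rw [scaffoldElement_add hcop t X hd]
    · rw [mul_zero]

end Scaffold

end RefinedBreaks

theorem mainTheorem3 {F K L : Type*} [Field F] [Field K] [Field L] [Algebra F K] [Algebra K L]
    (p : ℕ) [Fact p.Prime] [CharP F p] [PerfectField F]
    (vK : AddValuation K (WithTop ℤ)) (hK : RefinedBreaks.IsLocalField F vK)
    [FiniteDimensional K L] [IsGalois K L]
    (vL : AddValuation L (WithTop ℤ)) (hL : RefinedBreaks.IsTotallyRamified vK vL)
    (n : ℕ) (hn : 1 ≤ n) (hG : Nonempty (Gal(L/K) ≃* Multiplicative (Fin n → ZMod p)))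
    (b : ℕ) (hb : 0 < b) (hbreak : RefinedBreaks.ramificationBreaks K vL = {(b : ℤ)})
    (hAS : ∃ (β : K) (ω : Fin n → F) (ε : Fin n → K),
      RefinedBreaks.IsArtinSchreierData F L vK p n b β ω ε ∧
      -- `v_K(ε_i) > -b / p^(n-1)`
      ∀ i, ((-b : ℤ) : WithTop ℤ) < p ^ (n - 1) • vK (ε i)) :
    ∃ (lam : ℤ → L) (Ψ : Fin n → MonoidAlgebra F Gal(L/K)),
      RefinedBreaks.IsGaloisScaffold vK vL p n b lam
        (fun i => MonoidAlgebra.mapRingHom Gal(L/K) (algebraMap F K) (Ψ i)) (fun _ _ => 1) ∧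
      ∀ i, RefinedBreaks.InTruncSpan F Gal(L/K) p (Ideal.Quotient.mk _ (1 + Ψ i)) := by
  obtain ⟨β, ω, ε, hdata, hε⟩ := hAS
  obtain ⟨φ⟩ := hG
  have hp : p.Prime := Fact.out
  have hcharK : CharP K p := charP_of_injective_algebraMap (algebraMap F K).injective p
  have hcharL : CharP L p := charP_of_injective_algebraMap (algebraMap K L).injective p
  have hcard : Nat.card Gal(L/K) = p ^ n := by
    rw [Nat.card_congr φ.toEquiv]
    simp
  have hrank : Module.finrank K L = p ^ n := by
    rw [← IsGalois.card_aut_eq_finrank, hcard]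
  obtain ⟨x, hx, hgen⟩ := hdata.generates
  obtain ⟨τ, hτ⟩ := RefinedBreaks.exists_galois_translation hcard hx hgen
  obtain ⟨X, M, hX, hdiag, htri, hval⟩ := RefinedBreaks.exists_unitriangular_generators hK hL hb
    hbreak hτ (a₀ := fun i => ω i ^ p ^ n) (Y₀ := algebraMap K L β)
    (e₀ := fun i => algebraMap K L (ε i))
    (fun i => by rw [hx i, RefinedBreaks.coeffHom]; simp)
    (by rw [hL.val_base hdata.val_beta, hrank]; congr 1; push_cast; ring)
    -- Multiplying `p ^ (n - 1) * v_K(ε_i) > -b` by `p` gives `v_L(ε_i) > -b * p`.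
    (fun i => by
      rw [hL.map_base, hrank]
      by_cases h0 : ε i = 0
      · rw [h0, AddValuation.map_zero, ← Nat.sub_add_cancel (Nat.one_le_pow n p hp.pos), succ_nsmul]
        rw [add_top]
        exact WithTop.coe_lt_top _
      obtain ⟨m, hm⟩ := RefinedBreaks.exists_int_val vK h0
      have h := hε i
      rw [hm, RefinedBreaks.nsmul_coe_withTop, WithTop.coe_lt_coe] at h
      rw [hm, RefinedBreaks.nsmul_coe_withTop, WithTop.coe_lt_coe]
      have hpow : p ^ n = p ^ (n - 1) * p := by rw [← pow_succ, Nat.sub_add_cancel hn]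
      rw [hpow]
      have hp0 : (0 : ℤ) < p := by exact_mod_cast hp.pos
      push_cast at h ⊢
      nlinarith)
  -- The last generator has valuation `-b` and is moved by exactly `1`. If `p ∣ b`, the sharper
  -- bound would give `1` a valuation greater than `-b + b = 0`.
  have hcop : b.Coprime p := by
    rw [Nat.coprime_comm, hp.coprime_iff_not_dvd]
    rintro ⟨c, hc⟩
    let k : Fin n := ⟨n - 1, by omega⟩
    have hk : vL (X k) = ((p * (-c) : ℤ) : WithTop ℤ) := by
      rw [hval k]
      congr 1
      rw [show n - ((k : ℕ) + 1) = 0 by simp only [k]; omega, hc]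
      push_cast; ring
    have h := RefinedBreaks.add_lt_val_galois_sub_of_dvd hL p hb hbreak (τ k) hk
    rw [hX, hdiag, map_one, add_sub_cancel_left, AddValuation.map_one, hc] at h
    have : (p : ℤ) * (-c) + (p * c : ℕ) < 0 := by exact_mod_cast h
    push_cast at this
    linarith
  choose Θ hΘ hspan using
    RefinedBreaks.exists_isTranslation_single (p := p) (F := F) hX hdiag htri
  obtain ⟨t, ht⟩ := RefinedBreaks.exists_val_eq_one vK hK.normalized
  have hscaffold := RefinedBreaks.isGaloisScaffold_of_isTranslation hK hL hrank hb hcop hval hΘ ht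
  exact ⟨_, fun i => Θ i - 1, hscaffold, fun i => by rw [add_sub_cancel]; exact hspan i⟩
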